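/- For $a\in\mathbb{Q}$ let $F_a(x,y)=\left(y,\frac{a+y}{x}\right)$ be the Lyness map, defined for $x\neq 0$. A rational periodic point of $F_a$ of prime period $n\ge 1$ is a point $p\in\mathbb{Q}^2$ such that all iterates $F_a^k(p)$, $k\ge 0$, are defined (that is, every point of the forward orbit has nonzero first coordinate) and $n$ is the least positive integer with $F_a^n(p)=p$. **Proposition.** Let $a\in\mathbb{Q}$. Then $F_a$ does not have both a rational periodic point of prime period $1$ and a rational periodic point of prime period $12$; nor does $F_a$ have both a rational periodic point of prime period $2$ and a rational periodic point of prime period $12$. -/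

import Mathlib

/-- The formula of the Lyness map `F_a(x, y) = (y, (a + y) / x)` on `ℚ × ℚ`. It has its meaning
only at points with `x ≠ 0`; the points used below are those whose whole forward orbit
satisfies this, see `IsLynessPeriodicPoint`. -/
def lynessMap (a : ℚ) (p : ℚ × ℚ) : ℚ × ℚ :=
  (p.2, (a + p.2) / p.1)

/-- `p` is a rational periodic point of `F_a` of prime period `n`: every iterate of `F_a` is
genuinely defined at `p` (no division by zero ever occurs along the orbit), and `n` is the least
positive integer with `F_a^n(p) = p`. The condition `0 < n` is needed since
`Function.minimalPeriod` is `0` at points that are not periodic. -/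
def IsLynessPeriodicPoint (a : ℚ) (n : ℕ) (p : ℚ × ℚ) : Prop :=
  0 < n ∧ (∀ k : ℕ, ((lynessMap a)^[k] p).1 ≠ 0) ∧
    Function.minimalPeriod (lynessMap a) p = n

/-!
Write the Lyness recurrence as `x (k + 2) * x k = a + x (k + 1)`. On an orbit of period twelve,
running six steps forward and six steps backward from `x k` gives the same value. Equating the two
rational expressions, which differ by exchanging `x (k + 1)` and `x (k - 1)`, and discarding the
factors that force a shorter period leaves a quadratic equation whose discriminant shows that
`(1 - a) * (1 + 3 * a)` is a square. Likewise periods one and two make `1 + 4 * a` and `4 * a - 3`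
squares. Combined with period twelve, these give rational points on
`(t² + 15) (t² - 1) = w²` and `(t² + 3) (t² - 13) = w²` respectively. Clearing denominators, such
points are solutions of the concordant forms `v² - 16 y² = □`, `v² - m y² = □` with `m = 15` and
`m = 3`, which have only degenerate solutions by infinite descent: factoring the two differences of
squares writes `|v|` both as `m₁ α² + m₂ β²` and as `f² + 16 g²` with `α β = f g`, and the common
refinement of these two factorisations yields a smaller solution.
-/

section Divisibility

lemma exists_mul_mul_of_mul_eq_mul {M : Type*} [CommMonoidWithZero M] [IsCancelMulZero M]
    [DecompositionMonoid M] {α β γ δ : M} (h : α * β = γ * δ) (hα : α ≠ 0) :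
    ∃ a b c d, α = a * b ∧ γ = a * c ∧ β = c * d ∧ δ = b * d := by
  obtain ⟨a, b, ⟨c, rfl⟩, ⟨d, rfl⟩, rfl⟩ := exists_dvd_and_dvd_of_dvd_mul (Dvd.intro _ h)
  exact ⟨a, b, c, d, rfl, rfl, mul_left_cancel₀ hα (h.trans (mul_mul_mul_comm a c b d)), rfl⟩

lemma exists_eq_mul_of_isCoprime_of_mul_eq_mul {R : Type*} [CommRing R] [IsDomain R]
    {b c u v : R} (hbc : IsCoprime b c) (hc : c ≠ 0) (h : b * u = c * v) :
    ∃ e, u = c * e ∧ v = b * e := by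
  obtain ⟨e, rfl⟩ := hbc.symm.dvd_of_dvd_mul_left (Dvd.intro _ h.symm)
  exact ⟨e, rfl, mul_left_cancel₀ hc (by linear_combination -h)⟩

lemma dvd_of_isCoprime_of_dvd_mul {R : Type*} [CommSemiring R] {a d e n : R}
    (had : IsCoprime a d) (ha : e ∣ n * a) (hd : e ∣ n * d) : e ∣ n := by
  obtain ⟨x, y, hxy⟩ := had
  have hn : n = x * (n * a) + y * (n * d) := by
    calc n = n * (x * a + y * d) := by rw [hxy, mul_one]
      _ = _ := by ring
  exact hn ▸ (ha.mul_left x).add (hd.mul_left y)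

lemma exists_eq_sq_of_isCoprime_of_mul_eq_sq {s t k : ℤ} (hst : IsCoprime s t) (hs : 0 ≤ s)
    (ht : 0 ≤ t) (h : s * t = k ^ 2) : ∃ α β, s = α ^ 2 ∧ t = β ^ 2 ∧ α * β = k := by
  have exists_sq {x y : ℤ} (hxy : IsCoprime x y) (hx : 0 ≤ x) (h : x * y = k ^ 2) :
      ∃ γ, x = γ ^ 2 := by
    obtain ⟨γ, hγ | hγ⟩ := Int.sq_of_isCoprime hxy h
    · exact ⟨γ, hγ⟩
    · exact ⟨0, by nlinarith [sq_nonneg γ]⟩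
  obtain ⟨α, rfl⟩ := exists_sq hst hs h
  obtain ⟨β, rfl⟩ := exists_sq hst.symm ht ((mul_comm _ _).trans h)
  rcases sq_eq_sq_iff_eq_or_eq_neg.1 ((mul_pow α β 2).trans h) with hk | hk
  · exact ⟨α, β, rfl, rfl, hk⟩
  · exact ⟨-α, β, (neg_sq α).symm, rfl, by rw [neg_mul, hk, neg_neg]⟩

lemma exists_eq_mul_sq_of_isCoprime_of_mul_eq_mul_sq {m s t k : ℤ} (hm : 0 < m)
    (hst : IsCoprime s t) (hs : 0 ≤ s) (ht : 0 ≤ t) (h : s * t = m * k ^ 2) :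
    ∃ m₁ m₂ α β, 0 < m₁ ∧ m₁ * m₂ = m ∧ s = m₁ * α ^ 2 ∧ t = m₂ * β ^ 2 ∧ α * β = k := by
  obtain ⟨n₁, n₂, h₁, h₂, rfl⟩ := exists_dvd_and_dvd_of_dvd_mul (Dvd.intro _ h.symm)
  obtain ⟨s', rfl⟩ := (abs_dvd n₁ s).2 h₁
  obtain ⟨t', rfl⟩ := (abs_dvd n₂ t).2 h₂
  have hm' : |n₁| * |n₂| = n₁ * n₂ := by rw [← abs_mul, abs_of_pos hm]
  have h₁0 : 0 < |n₁| := abs_pos.2 (left_ne_zero_of_mul hm.ne')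
  have h₂0 : 0 < |n₂| := abs_pos.2 (right_ne_zero_of_mul hm.ne')
  have hst' : s' * t' = k ^ 2 := mul_left_cancel₀ hm.ne' (by
    rw [← hm', ← mul_mul_mul_comm, h, hm'])
  obtain ⟨α, β, rfl, rfl, hk⟩ := exists_eq_sq_of_isCoprime_of_mul_eq_sq
    hst.of_mul_left_right.of_mul_right_right (nonneg_of_mul_nonneg_right hs h₁0)
    (nonneg_of_mul_nonneg_right ht h₂0) hst'
  exact ⟨|n₁|, |n₂|, α, β, h₁0, hm', rfl, rfl, hk⟩

lemma isCoprime_of_mul_eq_squarefree_mul_sq {m s t k : ℤ} (hm : Squarefree m)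
    (h : s * t = m * k ^ 2) (hst : IsCoprime (s + t) k) : IsCoprime s t := by
  refine isCoprime_of_prime_dvd ?_ fun p hp hps hpt => ?_
  · rintro ⟨rfl, rfl⟩
    have hk : k = 0 := by simpa [hm.ne_zero] using h.symm
    rw [hk, add_zero] at hst
    exact not_isCoprime_zero_zero hst
  · have hpk : ¬ p ∣ k := fun hpk => hp.not_isUnit (hst.isUnit_of_dvd' (hps.add hpt) hpk)
    have hcop : IsCoprime p (k ^ 2) := ((hp.coprime_iff_not_dvd).2 hpk).pow_right
    have hdvd : p * p ∣ m * k ^ 2 := h ▸ mul_dvd_mul hps hpt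
    exact hp.not_isUnit (hm p ((hcop.mul_left hcop).dvd_of_dvd_mul_right hdvd))

lemma exists_mul_sq_add_mul_sq_eq_abs {m v k w : ℤ} (hm : 0 < m) (hsq : Squarefree m)
    (hvk : IsCoprime v k) (h : v ^ 2 - 4 * m * k ^ 2 = w ^ 2) :
    ∃ m₁ m₂ α β, 0 < m₁ ∧ m₁ ≤ m₂ ∧ m₁ * m₂ = m ∧ α * β = k ∧ IsCoprime α β ∧
      m₁ * α ^ 2 + m₂ * β ^ 2 = |v| := by
  obtain ⟨s, hs⟩ : Even (|v| - w) := by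
    have hpar : Even (|v| ^ 2 - w ^ 2) := ⟨2 * m * k ^ 2, by rw [sq_abs]; linear_combination h⟩
    simpa [Int.even_sub, Int.even_pow, even_abs] using hpar
  obtain ⟨t, ht⟩ : ∃ t, s + t = |v| := ⟨|v| - s, add_sub_cancel s _⟩
  have hprod : s * t = m * k ^ 2 := by
    have hw : w = t - s := by linear_combination -hs - ht
    rw [hw, ← sq_abs v, ← ht] at h
    linarith
  have hst0 : 0 ≤ s ∧ 0 ≤ t := by
    have hprod0 : 0 ≤ s * t := hprod ▸ by positivity
    have hsum0 : 0 ≤ s + t := ht ▸ abs_nonneg v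
    constructor <;> nlinarith
  have hcop : IsCoprime s t :=
    isCoprime_of_mul_eq_squarefree_mul_sq hsq hprod (ht ▸ hvk.abs_left)
  obtain ⟨m₁, m₂, α, β, hm₁, hm₁₂, rfl, rfl, hk⟩ :=
    exists_eq_mul_sq_of_isCoprime_of_mul_eq_mul_sq hm hcop hst0.1 hst0.2 hprod
  have hαβ : IsCoprime α β :=
    (IsCoprime.pow_iff two_pos two_pos).1 hcop.of_mul_left_right.of_mul_right_right
  rcases le_total m₁ m₂ with hle | hle
  · exact ⟨m₁, m₂, α, β, hm₁, hle, hm₁₂, hk, hαβ, ht⟩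
  · exact ⟨m₂, m₁, β, α, by nlinarith, hle, by rw [mul_comm, hm₁₂], by rw [mul_comm, hk],
      hαβ.symm, by rw [add_comm, ht]⟩

lemma exists_sq_add_sixteen_mul_sq_eq_abs {v k u : ℤ} (hv : Odd v) (hvk : IsCoprime v k)
    (h : v ^ 2 - 16 * (2 * k) ^ 2 = u ^ 2) :
    ∃ f g, Odd f ∧ f * g = k ∧ f ^ 2 + 16 * g ^ 2 = |v| := by
  have hv4 : IsCoprime v 4 := (Int.isCoprime_two_right.2 hv).pow_right (n := 2)
  obtain ⟨m₁, m₂, f, h', hm₁, hle, hm₁₂, hk, -, hsum⟩ :=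
    exists_mul_sq_add_mul_sq_eq_abs (m := 1) (w := u) one_pos squarefree_one
      (hv4.mul_right hvk) (by linear_combination h)
  obtain rfl : m₁ = 1 := by nlinarith
  obtain rfl : m₂ = 1 := by linarith
  have of_odd {f h' : ℤ} (hf : Odd f) (hk : f * h' = 4 * k) (hsum : f ^ 2 + h' ^ 2 = |v|) :
      ∃ f g, Odd f ∧ f * g = k ∧ f ^ 2 + 16 * g ^ 2 = |v| := by
    have hf4 : IsCoprime 4 f := (Int.isCoprime_two_left.2 hf).pow_left (m := 2)
    obtain ⟨g, rfl⟩ := hf4.dvd_of_dvd_mul_left (Dvd.intro _ hk.symm)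
    exact ⟨f, g, hf, by linarith, by linear_combination hsum⟩
  rcases Int.even_or_odd f with hf | hf
  · have hh : Odd h' := by
      have hodd : Odd (1 * f ^ 2 + 1 * h' ^ 2) := hsum ▸ odd_abs.2 hv
      simpa [Int.odd_add', Int.odd_pow, Int.even_pow, hf] using hodd
    exact of_odd hh ((mul_comm h' f).trans hk) (by linear_combination hsum)
  · exact of_odd hf hk (by linear_combination hsum)

end Divisibility

section Concordant

/-- The coprime pair `(v, y)` is a common solution of Euler's concordant forms
`v² - 16 y² = □` and `v² - m y² = □`. -/
structure IsConcordant (m v y : ℤ) : Prop where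
  isCoprime : IsCoprime v y
  isSquare_sub_sixteen : IsSquare (v ^ 2 - 16 * y ^ 2)
  isSquare_sub : IsSquare (v ^ 2 - m * y ^ 2)

/-- The values of `m` for which infinite descent on `IsConcordant m` closes up. The field `eq_one`
is the local obstruction: the descent leads to twisted forms
`m₁ a² - 16 d² = e c²`, `a² - m₂ d² = e b²`, and only the untwisted ones may survive. -/
structure IsDescentModulus (m : ℤ) : Prop where
  pos : 0 < m
  squarefree : Squarefree m
  emod_four : m % 4 = 3
  eq_one {m₁ m₂ e : ℤ} : 0 < m₁ → m₁ ≤ m₂ → m₁ * m₂ = m → e ∣ m - 16 → e ≡ m₁ [ZMOD 8] →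
    m₁ = 1 ∧ e = 1

lemma isDescentModulus_three : IsDescentModulus 3 where
  pos := by norm_num
  squarefree := Int.prime_three.squarefree
  emod_four := by norm_num
  eq_one {m₁ m₂ e} h₁ hle hm he hmod := by
    obtain rfl : m₁ = 1 := by nlinarith
    have he13 : e.natAbs ∣ 13 := by simpa using Int.natAbs_dvd_natAbs.2 he
    have := (Nat.dvd_prime (by norm_num)).1 he13
    rw [Int.modEq_iff_dvd] at hmod
    omega

lemma isDescentModulus_fifteen : IsDescentModulus 15 where
  pos := by norm_num
  squarefree := Int.squarefree_natAbs.1 (by decide +kernel)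
  emod_four := by norm_num
  eq_one {m₁ m₂ e} h₁ hle hm he hmod := by
    have hm₁ : m₁ ≤ 3 := by nlinarith
    have he1 : e ∣ 1 := by simpa using he
    have := Int.isUnit_iff.1 (isUnit_of_dvd_one he1)
    rw [Int.modEq_iff_dvd] at hmod
    omega

lemma sq_emod_eight (x : ℤ) : x ^ 2 % 8 = 0 ∨ x ^ 2 % 8 = 1 ∨ x ^ 2 % 8 = 4 := by
  have h : x % 8 = 0 ∨ x % 8 = 1 ∨ x % 8 = 2 ∨ x % 8 = 3 ∨ x % 8 = 4 ∨ x % 8 = 5 ∨ x % 8 = 6 ∨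
      x % 8 = 7 := by omega
  rcases h with h | h | h | h | h | h | h | h <;> simp [pow_two, Int.mul_emod, h]

lemma sq_emod_eight_eq_one_iff {x : ℤ} : x ^ 2 % 8 = 1 ↔ Odd x := by
  refine ⟨fun h => ?_, fun hx => ?_⟩
  · have hx : Odd (x ^ 2) := Int.odd_iff.2 (by omega)
    exact (Int.odd_pow' two_ne_zero).1 hx
  · have := Int.eight_dvd_sq_sub_one_of_odd hx
    omega

lemma two_dvd_of_sq_emod_eight_ne_one {x : ℤ} (hx : x ^ 2 % 8 ≠ 1) : 2 ∣ x :=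
  (Int.not_odd_iff_even.1 (mt sq_emod_eight_eq_one_iff.2 hx)).two_dvd

lemma mul_sq_emod_four_of_odd (m : ℤ) {y : ℤ} (hy : Odd y) : m * y ^ 2 % 4 = m % 4 := by
  rw [Int.mul_emod, Int.sq_mod_four_eq_one_of_odd hy, mul_one, Int.emod_emod]

lemma IsConcordant.even_right {m v y : ℤ} (h : IsConcordant m v y) (hm : m % 4 = 3)
    (hv : Odd v) : Even y := by
  obtain ⟨x, hx⟩ := h.isSquare_sub.exists_sq
  by_contra hy
  have := mul_sq_emod_four_of_odd m (Int.not_even_iff_odd.1 hy)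
  have := sq_emod_eight_eq_one_iff.2 hv
  have := sq_emod_eight x
  omega

lemma exists_isConcordant_of_mul_sq_add_mul_sq_eq {m m₁ m₂ α β f g : ℤ}
    (hm : IsDescentModulus m) (hm₁ : 0 < m₁) (hle : m₁ ≤ m₂) (hm₁₂ : m₁ * m₂ = m)
    (hαβ : IsCoprime α β) (h0 : α * β ≠ 0) (hf : Odd f) (hprod : α * β = f * g)
    (hsum : m₁ * α ^ 2 + m₂ * β ^ 2 = f ^ 2 + 16 * g ^ 2) :
    ∃ a d, IsConcordant m a d ∧ Odd a ∧ d ∣ β := by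
  obtain ⟨a, b, c, d, rfl, rfl, rfl, rfl⟩ :=
    exists_mul_mul_of_mul_eq_mul hprod (left_ne_zero_of_mul h0)
  obtain ⟨ha, hc⟩ := Int.odd_mul.1 hf
  have had : IsCoprime a d := hαβ.of_mul_left_left.of_mul_right_right
  have hbc : IsCoprime (b ^ 2) (c ^ 2) := hαβ.of_mul_left_right.of_mul_right_left.pow
  obtain ⟨e, hce, hbe⟩ : ∃ e, m₁ * a ^ 2 - 16 * d ^ 2 = c ^ 2 * e ∧
      a ^ 2 - m₂ * d ^ 2 = b ^ 2 * e :=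
    exists_eq_mul_of_isCoprime_of_mul_eq_mul hbc
      (pow_ne_zero 2 (left_ne_zero_of_mul (right_ne_zero_of_mul h0))) (by linear_combination hsum)
  have he : e ∣ m - 16 := dvd_of_isCoprime_of_dvd_mul (had.pow (m := 2) (n := 2))
    ⟨m₂ * c ^ 2 - 16 * b ^ 2, by linear_combination m₂ * hce - 16 * hbe - a ^ 2 * hm₁₂⟩
    ⟨c ^ 2 - m₁ * b ^ 2, by linear_combination hce - m₁ * hbe - d ^ 2 * hm₁₂⟩
  have hmod : e ≡ m₁ [ZMOD 8] := by
    have ha8 : a ^ 2 ≡ 1 [ZMOD 8] := sq_emod_eight_eq_one_iff.2 ha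
    have hc8 : c ^ 2 ≡ 1 [ZMOD 8] := sq_emod_eight_eq_one_iff.2 hc
    calc e = 1 * e := (one_mul e).symm
      _ ≡ c ^ 2 * e [ZMOD 8] := hc8.symm.mul_right e
      _ = m₁ * a ^ 2 - 16 * d ^ 2 := hce.symm
      _ ≡ m₁ * 1 - 0 [ZMOD 8] :=
        (ha8.mul_left m₁).sub (Int.modEq_zero_iff_dvd.2 ⟨2 * d ^ 2, by ring⟩)
      _ = m₁ := by ring
  obtain ⟨rfl, rfl⟩ := hm.eq_one hm₁ hle hm₁₂ he hmod
  obtain rfl : m₂ = m := (one_mul m₂).symm.trans hm₁₂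
  exact ⟨a, d, ⟨had, ⟨c, by linear_combination hce⟩, ⟨b, by linear_combination hbe⟩⟩, ha,
    dvd_mul_left d c⟩

lemma IsConcordant.exists_natAbs_lt {m v y : ℤ} (h : IsConcordant m v y)
    (hm : IsDescentModulus m) (hv : Odd v) (hy : y ≠ 0) :
    ∃ a d, IsConcordant m a d ∧ Odd a ∧ d ≠ 0 ∧ d.natAbs < y.natAbs := by
  obtain ⟨k, rfl⟩ := (h.even_right hm.emod_four hv).two_dvd
  obtain ⟨u, hu⟩ := h.isSquare_sub_sixteen.exists_sq
  obtain ⟨w, hw⟩ := h.isSquare_sub.exists_sq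
  have hvk : IsCoprime v k := h.isCoprime.of_mul_right_right
  have hk : k ≠ 0 := right_ne_zero_of_mul hy
  obtain ⟨f, g, hf, hfg, hsum'⟩ := exists_sq_add_sixteen_mul_sq_eq_abs hv hvk hu
  obtain ⟨m₁, m₂, α, β, hm₁, hle, hm₁₂, hαβ, hcop, hsum⟩ :=
    exists_mul_sq_add_mul_sq_eq_abs hm.pos hm.squarefree hvk
      (show v ^ 2 - 4 * m * k ^ 2 = w ^ 2 by linear_combination hw)
  obtain ⟨a, d, had, ha, hdβ⟩ := exists_isConcordant_of_mul_sq_add_mul_sq_eq hm hm₁ hle hm₁₂ hcop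
    (hαβ ▸ hk) hf (hαβ.trans hfg.symm) (hsum.trans hsum'.symm)
  have hdk : d ∣ k := hdβ.trans (hαβ ▸ dvd_mul_left β α)
  refine ⟨a, d, had, ha, ne_zero_of_dvd_ne_zero hk hdk, ?_⟩
  have := Nat.le_of_dvd (Int.natAbs_pos.2 hk) (Int.natAbs_dvd_natAbs.2 hdk)
  omega

theorem IsConcordant.eq_zero_of_odd {m v y : ℤ} (h : IsConcordant m v y)
    (hm : IsDescentModulus m) (hv : Odd v) : y = 0 := by
  induction hn : y.natAbs using Nat.strong_induction_on generalizing v y with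
  | _ n ih =>
    by_contra hy
    obtain ⟨a, d, had, ha, hd, hlt⟩ := h.exists_natAbs_lt hm hv hy
    exact hd (ih d.natAbs (hn ▸ hlt) had ha rfl)

lemma four_dvd_of_sq_sub_sixteen_mul_sq {u v y : ℤ} (hv : Even v) (hy : Odd y)
    (h : v ^ 2 - 16 * y ^ 2 = u ^ 2) : 4 ∣ v ∧ 4 ∣ u := by
  obtain ⟨v, rfl⟩ := hv.two_dvd
  have hu : Even u := by
    have : Even (u ^ 2) := h ▸ ⟨2 * v ^ 2 - 8 * y ^ 2, by ring⟩
    simpa [Int.even_pow] using this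
  obtain ⟨u, rfl⟩ := hu.two_dvd
  have hvu : v ^ 2 - 4 * y ^ 2 = u ^ 2 := by linarith
  have := sq_emod_eight_eq_one_iff.2 hy
  have hu' := sq_emod_eight u
  have hv' := sq_emod_eight v
  exact ⟨mul_dvd_mul_left 2 (two_dvd_of_sq_emod_eight_ne_one (by omega)),
    mul_dvd_mul_left 2 (two_dvd_of_sq_emod_eight_ne_one (by omega))⟩

lemma IsConcordant.odd_right_of_even {m v y : ℤ} (h : IsConcordant m v y) (hv : Even v) :
    Odd y :=
  Int.isCoprime_two_left.1 (h.isCoprime.of_isCoprime_of_dvd_left hv.two_dvd)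

theorem IsConcordant.eq_zero_of_three {v y : ℤ} (h : IsConcordant 3 v y) : y = 0 := by
  refine h.eq_zero_of_odd isDescentModulus_three (Int.not_even_iff_odd.1 fun hv => ?_)
  have hy := h.odd_right_of_even hv
  obtain ⟨u, hu⟩ := h.isSquare_sub_sixteen.exists_sq
  obtain ⟨x, hx⟩ := h.isSquare_sub.exists_sq
  obtain ⟨v, rfl⟩ := (four_dvd_of_sq_sub_sixteen_mul_sq hv hy hu).1
  have hx' : 16 * v ^ 2 - 3 * y ^ 2 = x ^ 2 := by linear_combination hx
  have := sq_emod_eight_eq_one_iff.2 hy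
  have := sq_emod_eight x
  omega

theorem IsConcordant.eq_zero_or_sq_eq_of_fifteen {v y : ℤ} (h : IsConcordant 15 v y) :
    y = 0 ∨ v ^ 2 = 16 * y ^ 2 := by
  rcases Int.even_or_odd v with hv | hv
  swap
  · exact .inl (h.eq_zero_of_odd isDescentModulus_fifteen hv)
  have hy := h.odd_right_of_even hv
  obtain ⟨u, hu⟩ := h.isSquare_sub_sixteen.exists_sq
  obtain ⟨x, hx⟩ := h.isSquare_sub.exists_sq
  obtain ⟨⟨v, rfl⟩, u, rfl⟩ := four_dvd_of_sq_sub_sixteen_mul_sq hv hy hu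
  have hy2 : x ^ 2 - 16 * u ^ 2 = y ^ 2 := by linear_combination hu - hx
  have hv2 : x ^ 2 - 15 * u ^ 2 = v ^ 2 := by linarith
  have hxu : IsCoprime x u := by
    obtain ⟨p, q, hpq⟩ : IsCoprime (v ^ 2) (y ^ 2) := h.isCoprime.of_mul_left_right.pow
    exact (IsCoprime.pow_iff two_pos two_pos).1
      ⟨p + q, -15 * p - 16 * q, by linear_combination hpq + p * hv2 + q * hy2⟩
  have hx_odd : Odd x := by
    have : 16 * v ^ 2 - 15 * y ^ 2 = x ^ 2 := by linear_combination hx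
    have := sq_emod_eight_eq_one_iff.2 hy
    exact sq_emod_eight_eq_one_iff.1 (by omega)
  obtain rfl : u = 0 := (IsConcordant.mk hxu (isSquare_iff_exists_sq _ |>.2 ⟨y, hy2⟩)
    (isSquare_iff_exists_sq _ |>.2 ⟨v, hv2⟩)).eq_zero_of_odd isDescentModulus_fifteen hx_odd
  exact .inr (by linear_combination hu)

end Concordant

section ProductOfConcordantForms

lemma exists_squarefree_mul_sq_of_mul_eq_sq {P Q w : ℤ} (hP : 0 < P) (h : P * Q = w ^ 2) :
    ∃ g r s, 0 < g ∧ Squarefree g ∧ P = g * r ^ 2 ∧ Q = g * s ^ 2 := by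
  lift P to ℕ using hP.le
  obtain ⟨g, r, hg, hr, rfl, hsq⟩ := Nat.sq_mul_squarefree_of_pos (Int.natCast_pos.1 hP)
  push_cast at h ⊢
  obtain ⟨w, rfl⟩ : (r : ℤ) ∣ w :=
    (Int.pow_dvd_pow_iff two_ne_zero).1 ⟨g * Q, by rw [← h, mul_assoc]⟩
  have hw : g * Q = w ^ 2 := mul_left_cancel₀ (show (r : ℤ) ^ 2 ≠ 0 by positivity)
    (by linear_combination h)
  have hsq' : Squarefree (g : ℤ) := Int.squarefree_natCast.2 hsq
  obtain ⟨s, rfl⟩ := (hsq'.dvd_pow_iff_dvd two_ne_zero).1 (Dvd.intro _ hw)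
  exact ⟨g, r, s, Int.natCast_pos.2 hg, hsq', mul_comm _ _,
    mul_left_cancel₀ hsq'.ne_zero (by linear_combination hw)⟩

lemma two_mul_sq_ne_of_emod_four {m x y r s : ℤ} (hm : m % 4 = 3) (hxy : IsCoprime x y)
    (hP : x ^ 2 + m * y ^ 2 = 2 * r ^ 2) : x ^ 2 + (m - 16) * y ^ 2 ≠ 2 * s ^ 2 := by
  intro hQ
  have hrs : r ^ 2 - s ^ 2 = 8 * y ^ 2 := by linarith
  have hy : Odd y := by
    by_contra hy
    obtain ⟨k, rfl⟩ := (Int.not_odd_iff_even.1 hy).two_dvd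
    have hx : Odd x := Int.isCoprime_two_right.1 hxy.of_mul_right_left
    have := sq_emod_eight_eq_one_iff.2 hx
    have hP' : x ^ 2 + 4 * (m * k ^ 2) = 2 * r ^ 2 := by linear_combination hP
    omega
  have hy8 := sq_emod_eight_eq_one_iff.2 hy
  have hmy := mul_sq_emod_four_of_odd m hy
  have hr : r ^ 2 % 8 ≠ 1 := by
    have := sq_emod_eight x
    omega
  obtain ⟨r, rfl⟩ := two_dvd_of_sq_emod_eight_ne_one hr
  obtain ⟨s, rfl⟩ := two_dvd_of_sq_emod_eight_ne_one (x := s) (by omega)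
  have hrs' : r ^ 2 - s ^ 2 = 2 * y ^ 2 := by linarith
  have := sq_emod_eight r
  have := sq_emod_eight s
  omega

lemma exists_isConcordant_of_mul_eq_sq {m x y w : ℤ} (hm : 0 < m) (hm4 : m % 4 = 3)
    (hxy : IsCoprime x y)
    (h : (x ^ 2 + m * y ^ 2) * (x ^ 2 + (m - 16) * y ^ 2) = w ^ 2) :
    ∃ v, IsConcordant m v y ∧ v ^ 2 = x ^ 2 + m * y ^ 2 := by
  have hP0 : 0 < x ^ 2 + m * y ^ 2 := by
    rcases eq_or_ne y 0 with rfl | hy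
    · have hx : x ≠ 0 := by rintro rfl; exact not_isCoprime_zero_zero hxy
      positivity
    · positivity
  obtain ⟨g, r, s, hg0, hg, hP, hQ⟩ := exists_squarefree_mul_sq_of_mul_eq_sq hP0 h
  have hg16 : g ∣ 2 ^ 4 := dvd_of_isCoprime_of_dvd_mul (hxy.pow (m := 2) (n := 2))
    ⟨m * s ^ 2 - (m - 16) * r ^ 2, by linear_combination m * hQ - (m - 16) * hP⟩
    ⟨r ^ 2 - s ^ 2, by linear_combination hP - hQ⟩
  have hg2 : g ≤ 2 := Int.le_of_dvd two_pos ((hg.dvd_pow_iff_dvd four_ne_zero).1 hg16)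
  obtain rfl | rfl : g = 2 ∨ g = 1 := by omega
  · exact absurd hQ (two_mul_sq_ne_of_emod_four hm4 hxy hP)
  · have hv : IsCoprime (r ^ 2) (y ^ 2) := by
      rw [show r ^ 2 = x ^ 2 + y ^ 2 * m by linarith]
      exact (IsCoprime.add_mul_left_left_iff).2 hxy.pow
    exact ⟨r, ⟨(IsCoprime.pow_iff two_pos two_pos).1 hv, ⟨s, by linarith⟩, ⟨x, by linarith⟩⟩,
      by linarith⟩

lemma exists_isConcordant_num_den {m : ℤ} (hm : 0 < m) (hm4 : m % 4 = 3) {t w : ℚ}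
    (h : (t ^ 2 + m) * (t ^ 2 + (m - 16)) = w ^ 2) :
    ∃ v, IsConcordant m v t.den ∧ v ^ 2 = t.num ^ 2 + m * t.den ^ 2 := by
  have hsq : IsSquare ((t.num ^ 2 + m * t.den ^ 2) * (t.num ^ 2 + (m - 16) * t.den ^ 2)) := by
    refine Rat.isSquare_intCast_iff.1 ⟨w * t.den ^ 2, ?_⟩
    have ht : (t.num : ℚ) = t * t.den := (Rat.mul_den_eq_num t).symm
    push_cast
    rw [ht]
    linear_combination (t.den : ℚ) ^ 4 * h
  obtain ⟨w', hw'⟩ := hsq.exists_sq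
  exact exists_isConcordant_of_mul_eq_sq hm hm4 t.isCoprime_num_den hw'

theorem sq_add_three_mul_sq_sub_thirteen_ne_sq (t w : ℚ) : (t ^ 2 + 3) * (t ^ 2 - 13) ≠ w ^ 2 := by
  intro h
  obtain ⟨v, hv, -⟩ := exists_isConcordant_num_den (m := 3) (by norm_num) (by norm_num) (t := t)
    (w := w) (by push_cast; linear_combination h)
  exact t.den_ne_zero (by exact_mod_cast hv.eq_zero_of_three)

theorem sq_eq_one_of_sq_add_fifteen_mul_sq_sub_one_eq_sq {t w : ℚ}
    (h : (t ^ 2 + 15) * (t ^ 2 - 1) = w ^ 2) : t ^ 2 = 1 := by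
  obtain ⟨v, hv, hvt⟩ := exists_isConcordant_num_den (m := 15) (by norm_num) (by norm_num) (t := t)
    (w := w) (by push_cast; linear_combination h)
  have hden : (t.den : ℤ) ≠ 0 := by exact_mod_cast t.den_ne_zero
  have hnum : t.num ^ 2 = (t.den : ℤ) ^ 2 := by
    linarith [hv.eq_zero_or_sq_eq_of_fifteen.resolve_left hden]
  rw [← Rat.num_div_den t, div_pow, div_eq_one_iff_eq (by positivity)]
  exact_mod_cast hnum

end ProductOfConcordantForms

section LynessSequence

variable {K : Type*} [Field K] {a : K}

/-- A solution `x : ZMod n → K` of the Lyness recurrence `x (k + 2) = (a + x (k + 1)) / x k`, that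
is, a cyclic orbit of length `n` of the Lyness map, or a two-sided infinite orbit if `n = 0`. The
point of the orbit at time `k` is `(x k, x (k + 1))`. -/
structure IsLynessSeq {n : ℕ} (a : K) (x : ZMod n → K) : Prop where
  ne_zero (k : ZMod n) : x k ≠ 0
  recurrence (k : ZMod n) : x (k + 2) * x k = a + x (k + 1)

/-- The numerator of the sixth iterate of the Lyness recurrence, see `IsLynessSeq.add_six`. -/
def lynessSixNum (a y z : K) : K :=
  z * (a * (a + z) * (a * (y + 1) + z) + y * (a * z * (a + z) + a * y * z + a * (y + 1) + z))

/-- The denominator of the sixth iterate of the Lyness recurrence, see `IsLynessSeq.add_six`. -/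
def lynessSixDen (a y z : K) : K :=
  (a * (y + 1) + z) * (a * y * z + a * (y + 1) + z)

namespace IsLynessSeq

variable {n : ℕ} {x : ZMod n → K}

lemma recurrence_of_eq (h : IsLynessSeq a x) {i j l : ZMod n} (hj : j = i + 1 := by ring)
    (hl : l = i + 2 := by ring) : x l * x i = a + x j := by
  rw [hj, hl, h.recurrence]

lemma comp_neg (h : IsLynessSeq a x) : IsLynessSeq a fun k => x (-k) where
  ne_zero k := h.ne_zero (-k)
  recurrence k := by
    rw [mul_comm]
    exact h.recurrence_of_eq

lemma add_six (h : IsLynessSeq a x) (k : ZMod n) :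
    x (k + 6) * lynessSixDen a (x k) (x (k + 1)) = lynessSixNum a (x k) (x (k + 1)) := by
  have e₂ : x (k + 2) * x k = a + x (k + 1) := h.recurrence k
  have e₃ : x (k + 3) * x (k + 1) = a + x (k + 2) := h.recurrence_of_eq
  have e₄ : x (k + 4) * x (k + 2) = a + x (k + 3) := h.recurrence_of_eq
  have e₅ : x (k + 5) * x (k + 3) = a + x (k + 4) := h.recurrence_of_eq
  have e₆ : x (k + 6) * x (k + 4) = a + x (k + 5) := h.recurrence_of_eq
  unfold lynessSixDen lynessSixNum
  generalize x k = y, x (k + 1) = z, x (k + 2) = x₂, x (k + 3) = x₃, x (k + 4) = x₄,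
    x (k + 5) = x₅, x (k + 6) = x₆ at e₂ e₃ e₄ e₅ e₆ ⊢
  have d₃ : a * (y + 1) + z = y * z * x₃ := by linear_combination -y * e₃ - e₂
  have d₄ : a * y * z + a * (y + 1) + z = y * z * x₂ * x₄ := by
    linear_combination d₃ - y * z * e₄
  have d₅ : a * z * (a + z) + a * y * z + a * (y + 1) + z = y * z * x₂ * x₃ * x₅ := by
    linear_combination d₄ - a * z * e₂ - y * z * x₂ * e₅
  have d₆ : a * (a + z) * (y * z * x₃) + y * (y * z * x₂ * x₃ * x₅) =
      y ^ 2 * z * x₂ * x₃ * x₄ * x₆ := by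
    linear_combination -a * (y * z * x₃) * e₂ - y ^ 2 * z * x₂ * x₃ * e₆
  rw [d₃, d₄, d₅, d₆]
  ring

end IsLynessSeq

lemma lynessSixNum_mul_lynessSixDen_sub {y z z' u : K} (h : z * z' = a + y)
    (hu : u = (1 - a) * y + a * (y + 1) * (z + z' + y + a + 1)) :
    lynessSixNum a y z * lynessSixDen a y z' - lynessSixNum a y z' * lynessSixDen a y z =
      a * (y + 1) * (z - z') * (u ^ 2 + (1 - a) ^ 2 * y * u - a * (1 - a) ^ 3 * y ^ 2) := by
  obtain rfl : y = z * z' - a := by rw [h]; ring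
  rw [hu, lynessSixNum, lynessSixDen, lynessSixNum, lynessSixDen]
  ring

lemma isSquare_of_quadratic_eq_zero {y u : K} (hy : y ≠ 0) (ha : a ≠ 1)
    (h : u ^ 2 + (1 - a) ^ 2 * y * u - a * (1 - a) ^ 3 * y ^ 2 = 0) :
    IsSquare ((1 - a) * (1 + 3 * a)) := by
  have ha' : 1 - a ≠ 0 := sub_ne_zero.2 ha.symm
  -- The quadratic polynomial in `u` has discriminant `(1 - a)³ * (1 + 3 * a) * y²`.
  refine ⟨(2 * u + (1 - a) ^ 2 * y) / ((1 - a) * y), ?_⟩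
  field_simp
  linear_combination -4 * h

namespace IsLynessSeq

lemma eq_neg_one_or_eq_or_isSquare {x : ZMod 12 → K} (h : IsLynessSeq a x) (ha₀ : a ≠ 0)
    (ha₁ : a ≠ 1) (k : ZMod 12) :
    x k = -1 ∨ x (k + 1) = x (k - 1) ∨ IsSquare ((1 - a) * (1 + 3 * a)) := by
  have hforward := h.add_six k
  have hbackward : x (k + 6) * lynessSixDen a (x k) (x (k - 1)) =
      lynessSixNum a (x k) (x (k - 1)) := by
    have hpred : -(-k + 1) = k - 1 := by ring
    have hhalf : -(-k + 6) = k + 6 := by rw [neg_add, neg_neg]; rfl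
    simpa only [neg_neg, hpred, hhalf] using h.comp_neg.add_six (-k)
  have hadj : x (k + 1) * x (k - 1) = a + x k := h.recurrence_of_eq
  have key := lynessSixNum_mul_lynessSixDen_sub hadj rfl
  rw [← hforward, ← hbackward, mul_right_comm, sub_self, eq_comm] at key
  rcases mul_eq_zero.1 key with hlin | hquad
  · rcases mul_eq_zero.1 hlin with hk | hk
    · exact .inl (eq_neg_of_add_eq_zero_left ((mul_eq_zero.1 hk).resolve_left ha₀))
    · exact .inr (.inl (sub_eq_zero.1 hk))
  · exact .inr (.inr (isSquare_of_quadratic_eq_zero (h.ne_zero k) ha₁ hquad))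

variable {n : ℕ} {x : ZMod n → K}

lemma add_six_of_eq_zero (h : IsLynessSeq 0 x) (k : ZMod n) : x (k + 6) = x k := by
  have inv (k : ZMod n) : x (k + 3) * x k = 1 := by
    have e₂ : x (k + 2) * x k = 0 + x (k + 1) := h.recurrence k
    have e₃ : x (k + 3) * x (k + 1) = 0 + x (k + 2) := h.recurrence_of_eq
    exact mul_right_cancel₀ (h.ne_zero (k + 1)) (by linear_combination x k * e₃ + e₂)
  have hsix : x (k + 6) * x (k + 3) = 1 := by
    simpa [add_assoc, show (3 : ZMod n) + 3 = 6 by norm_num] using inv (k + 3)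
  exact mul_right_cancel₀ (h.ne_zero (k + 3)) (by linear_combination hsix - inv k)

lemma add_five_of_eq_one (h : IsLynessSeq 1 x) (k : ZMod n) : x (k + 5) = x k := by
  have e₂ : x (k + 2) * x k = 1 + x (k + 1) := h.recurrence k
  have e₃ : x (k + 3) * x (k + 1) = 1 + x (k + 2) := h.recurrence_of_eq
  have e₄ : x (k + 4) * x (k + 2) = 1 + x (k + 3) := h.recurrence_of_eq
  have e₅ : x (k + 5) * x (k + 3) = 1 + x (k + 4) := h.recurrence_of_eq
  have d₄ : x (k + 4) * x (k + 1) = 1 + x k := mul_right_cancel₀ (h.ne_zero (k + 2))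
    (by linear_combination x (k + 1) * e₄ + e₃ - e₂)
  exact mul_right_cancel₀ (mul_ne_zero (h.ne_zero (k + 3)) (h.ne_zero (k + 1)))
    (by linear_combination x (k + 1) * e₅ + d₄ - x k * e₃ - e₂)

lemma add_three_of_eq_neg_one (h : IsLynessSeq a x) (ha : a ≠ 1) {k : ZMod n}
    (h₀ : x k = -1) (h₁ : x (k + 1) = -1) : x (k + 3) = -1 ∧ x (k + 3 + 1) = -1 := by
  have e₂ : x (k + 2) * x k = a + x (k + 1) := h.recurrence k
  have e₃ : x (k + 3) * x (k + 1) = a + x (k + 2) := h.recurrence_of_eq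
  have e₄ : x (k + 3 + 1) * x (k + 2) = a + x (k + 3) := h.recurrence_of_eq
  have h₂ : x (k + 2) = 1 - a := by linear_combination -e₂ + x (k + 2) * h₀ - h₁
  have h₃ : x (k + 3) = -1 := by linear_combination -e₃ + x (k + 3) * h₁ - h₂
  rw [h₂, h₃] at e₄
  exact ⟨h₃, mul_right_cancel₀ (sub_ne_zero.2 ha.symm) (by linear_combination e₄)⟩

theorem isSquare_of_injective {x : ZMod 12 → K} (h : IsLynessSeq a x)
    (hinj : Function.Injective fun k => (x k, x (k + 1))) :
    a ≠ 0 ∧ a ≠ 1 ∧ IsSquare ((1 - a) * (1 + 3 * a)) := by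
  have eq_zero_of_shift {d k : ZMod 12} (h₀ : x (k + d) = x k) (h₁ : x (k + d + 1) = x (k + 1)) :
      d = 0 := by simpa using hinj (Prod.ext h₀ h₁)
  have eq_zero_of_periodic {d : ZMod 12} (hd : ∀ k, x (k + d) = x k) : d = 0 :=
    eq_zero_of_shift (hd 0) (by rw [add_right_comm, hd])
  have ha₀ : a ≠ 0 := by
    rintro rfl
    exact absurd (eq_zero_of_periodic h.add_six_of_eq_zero) (by decide)
  have ha₁ : a ≠ 1 := by
    rintro rfl
    exact absurd (eq_zero_of_periodic h.add_five_of_eq_one) (by decide)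
  refine ⟨ha₀, ha₁, by_contra fun hsq => ?_⟩
  have step (k : ZMod 12) : x k = -1 ∨ x (k + 1) = x (k - 1) :=
    (h.eq_neg_one_or_eq_or_isSquare ha₀ ha₁ k).imp_right fun h => h.resolve_right hsq
  have no_neg_one_pair {k : ZMod 12} (h₀ : x k = -1) : x (k + 1) ≠ -1 := fun h₁ => by
    obtain ⟨h₃, h₄⟩ := h.add_three_of_eq_neg_one ha₁ h₀ h₁
    exact absurd (eq_zero_of_shift (h₃.trans h₀.symm) (h₄.trans h₁.symm)) (by decide)
  have no_neg_one (k : ZMod 12) : x k ≠ -1 := fun h₀ => by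
    have h₂ : x (k + 2) = x k := by
      simpa [add_assoc, one_add_one_eq_two] using (step (k + 1)).resolve_left (no_neg_one_pair h₀)
    have e₂ : x (k + 2) * x k = a + x (k + 1) := h.recurrence k
    have e₃ : x (k + 2 + 1) * x (k + 1) = a + x (k + 2) := h.recurrence_of_eq
    refine no_neg_one_pair (h₂.trans h₀) (mul_right_cancel₀ (h.ne_zero (k + 1)) ?_)
    rw [h₂, h₀] at e₂ e₃
    linear_combination e₃ - e₂
  have period_two (k : ZMod 12) : x (k + 2) = x k := by
    simpa [add_assoc, one_add_one_eq_two] using (step (k + 1)).resolve_left (no_neg_one _)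
  exact absurd (eq_zero_of_periodic period_two) (by decide)

end IsLynessSeq

end LynessSequence

section PeriodicPoint

/-- The first coordinates of the orbit of `p` under the Lyness map, indexed by the time modulo `n`;
this is meaningful only if `n` is a period of `p`. -/
def lynessOrbit (a : ℚ) (n : ℕ) (p : ℚ × ℚ) (k : ZMod n) : ℚ :=
  ((lynessMap a)^[k.val] p).1

namespace IsLynessPeriodicPoint

variable {a : ℚ} {n : ℕ} {p : ℚ × ℚ}

lemma iterate_val_natCast (h : IsLynessPeriodicPoint a n p) (k : ℕ) :
    (lynessMap a)^[(k : ZMod n).val] p = (lynessMap a)^[k] p := by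
  have hper : Function.IsPeriodicPt (lynessMap a) n p :=
    h.2.2 ▸ Function.isPeriodicPt_minimalPeriod _ p
  rw [ZMod.val_natCast, hper.iterate_mod_apply]

lemma lynessOrbit_natCast (h : IsLynessPeriodicPoint a n p) (k : ℕ) :
    lynessOrbit a n p k = ((lynessMap a)^[k] p).1 := by
  rw [lynessOrbit, h.iterate_val_natCast]

lemma lynessOrbit_add_one (h : IsLynessPeriodicPoint a n p) (k : ℕ) :
    lynessOrbit a n p (k + 1) = ((lynessMap a)^[k] p).2 := by
  rw [← Nat.cast_succ, h.lynessOrbit_natCast, Function.iterate_succ_apply']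
  rfl

lemma isLynessSeq (h : IsLynessPeriodicPoint a n p) : IsLynessSeq a (lynessOrbit a n p) where
  ne_zero k := h.2.1 k.val
  recurrence k := by
    have : NeZero n := ⟨h.1.ne'⟩
    obtain ⟨k, rfl⟩ := ZMod.natCast_zmod_surjective k
    have hk : (k : ZMod n) + 2 = ((k + 1 : ℕ) : ZMod n) + 1 := by push_cast; ring
    rw [hk, h.lynessOrbit_add_one, h.lynessOrbit_add_one, h.lynessOrbit_natCast,
      Function.iterate_succ_apply']
    exact div_mul_cancel₀ _ (h.2.1 k)

lemma injective_lynessOrbit (h : IsLynessPeriodicPoint a n p) :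
    Function.Injective fun k => (lynessOrbit a n p k, lynessOrbit a n p (k + 1)) := by
  have : NeZero n := ⟨h.1.ne'⟩
  intro k l hkl
  have orbit (k : ZMod n) :
      (lynessOrbit a n p k, lynessOrbit a n p (k + 1)) = (lynessMap a)^[k.val] p :=
    Prod.ext rfl (by simpa using h.lynessOrbit_add_one k.val)
  simp only [orbit] at hkl
  have hmem (k : ZMod n) : k.val ∈ Set.Iio (Function.minimalPeriod (lynessMap a) p) :=
    h.2.2.symm ▸ k.val_lt
  exact ZMod.val_injective n (Function.iterate_injOn_Iio_minimalPeriod (hmem k) (hmem l) hkl)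

lemma isSquare_of_period_twelve (h : IsLynessPeriodicPoint a 12 p) :
    a ≠ 0 ∧ a ≠ 1 ∧ IsSquare ((1 - a) * (1 + 3 * a)) :=
  h.isLynessSeq.isSquare_of_injective h.injective_lynessOrbit

lemma isSquare_of_period_one (h : IsLynessPeriodicPoint a 1 p) : IsSquare (1 + 4 * a) := by
  have e := h.isLynessSeq.recurrence 0
  rw [Subsingleton.elim (0 + 2 : ZMod 1) 0, Subsingleton.elim (0 + 1 : ZMod 1) 0] at e
  exact ⟨2 * lynessOrbit a 1 p 0 - 1, by linear_combination -4 * e⟩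

lemma isSquare_of_period_two (h : IsLynessPeriodicPoint a 2 p) : IsSquare (4 * a - 3) := by
  have e₀ : lynessOrbit a 2 p 0 * lynessOrbit a 2 p 0 = a + lynessOrbit a 2 p 1 :=
    h.isLynessSeq.recurrence 0
  have e₁ : lynessOrbit a 2 p 1 * lynessOrbit a 2 p 1 = a + lynessOrbit a 2 p 0 :=
    h.isLynessSeq.recurrence 1
  have hne : lynessOrbit a 2 p 0 ≠ lynessOrbit a 2 p 1 := fun heq =>
    zero_ne_one (h.injective_lynessOrbit (a₁ := 0) (a₂ := 1) (Prod.ext heq heq.symm))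
  have hsum : lynessOrbit a 2 p 0 + lynessOrbit a 2 p 1 = -1 :=
    mul_left_cancel₀ (sub_ne_zero.2 hne) (by linear_combination e₀ - e₁)
  exact ⟨lynessOrbit a 2 p 0 - lynessOrbit a 2 p 1, by
    linear_combination -2 * e₀ - 2 * e₁ + (lynessOrbit a 2 p 0 + lynessOrbit a 2 p 1 - 3) * hsum⟩

end IsLynessPeriodicPoint

lemma not_isSquare_one_add_four_mul {a : ℚ} (ha : a ≠ 0) (h : IsSquare ((1 - a) * (1 + 3 * a))) :
    ¬ IsSquare (1 + 4 * a) := by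
  rintro ⟨c, hc⟩
  obtain ⟨d, hd⟩ := h
  have hsum : (d + c) ^ 2 = 2 + 6 * a - 3 * a ^ 2 + 2 * (d * c) := by
    linear_combination -hc - hd
  have ht : (((d + c) / a) ^ 2 + 15) * (((d + c) / a) ^ 2 - 1) =
      (2 * (d * (1 + 2 * a) + c * (1 + a)) / a ^ 2) ^ 2 := by
    -- If `1 - a = p²` and `1 + 3 * a = r²` with `d = p * r`, then the two factors on the left are
    -- `((p + r * c) / a)²` and `((r + p * c) / a)²`.
    rw [div_pow, hsum]
    field_simp
    linear_combination (4 * (1 + 2 * a) ^ 2 - 4 * c ^ 2) * hd -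
      (4 * ((1 - a) * (1 + 3 * a)) - 4 * (1 + a) ^ 2) * hc
  have hsq : (d + c) ^ 2 = a ^ 2 := by
    have := sq_eq_one_of_sq_add_fifteen_mul_sq_sub_one_eq_sq ht
    rwa [div_pow, div_eq_one_iff_eq (pow_ne_zero 2 ha)] at this
  have hdc : d * c = 2 * a ^ 2 - 3 * a - 1 := by linarith
  have h4 : a ^ 4 = 0 := by
    linear_combination -(d * c + (2 * a ^ 2 - 3 * a - 1)) / 4 * hdc - (1 + 4 * a) / 4 * hd -
      d ^ 2 / 4 * hc
  exact ha (pow_eq_zero_iff four_ne_zero |>.1 h4)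

lemma not_isSquare_four_mul_sub_three {a : ℚ} (ha : a ≠ 1)
    (h : IsSquare ((1 - a) * (1 + 3 * a))) : ¬ IsSquare (4 * a - 3) := by
  rintro ⟨c, hc⟩
  obtain ⟨d, hd⟩ := h
  have ha' : 1 - a ≠ 0 := sub_ne_zero.2 ha.symm
  refine sq_add_three_mul_sq_sub_thirteen_ne_sq (d / (1 - a)) (4 * c / (1 - a)) ?_
  have ht : (d / (1 - a)) ^ 2 = (1 + 3 * a) / (1 - a) := by
    field_simp
    linear_combination -hd
  rw [ht]
  field_simp
  linear_combination 16 * hc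

end PeriodicPoint

theorem mainTheorem6 (a : ℚ) :
    ¬ ((∃ p : ℚ × ℚ, IsLynessPeriodicPoint a 1 p) ∧
        (∃ q : ℚ × ℚ, IsLynessPeriodicPoint a 12 q)) ∧
    ¬ ((∃ p : ℚ × ℚ, IsLynessPeriodicPoint a 2 p) ∧
        (∃ q : ℚ × ℚ, IsLynessPeriodicPoint a 12 q)) := by
  constructor
  · rintro ⟨⟨p, hp⟩, q, hq⟩
    obtain ⟨ha, -, hsq⟩ := hq.isSquare_of_period_twelve
    exact not_isSquare_one_add_four_mul ha hsq hp.isSquare_of_period_one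
  · rintro ⟨⟨p, hp⟩, q, hq⟩
    obtain ⟨-, ha, hsq⟩ := hq.isSquare_of_period_twelve
    exact not_isSquare_four_mul_sub_three ha hsq hp.isSquare_of_period_two
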